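/- Let $G$ be a finite connected graph. Consider the following process on $G$ with two strategies, $1$ and $2$, and $p=0$. Each vertex starts with a strategy chosen independently and uniformly at random from $\{1,2\}$. At each time step $t=1,2,\dots$ an edge of $G$ is chosen uniformly at random, independently of everything else, and both its endpoints adopt the lower of their two current strategies. Let $T_G$ be the first time $t\ge 0$ at which all vertices have the same strategy. For $n\ge 2$ let $J_n$ be a jellyfish graph on $n$ vertices: a clique with $k$ pendant paths, each containing $l$ vertices outside the clique, where $k$ is $n/(\log_2 n)^2$ rounded up or down to an integer, $l$ is $2\log_2 n$ rounded up or down to an integer, and the clique consists of the remaining $n-kl$ vertices (so it has size $n-2n/\log_2 n$ up to rounding). Each path is attached by an edge from one of its ends to a vertex of the clique, and the paths are attached as evenly as possible, that is, the numbers of paths attached to any two vertices of the clique differ by at most one. Theorem. $\mathbb{E}[T_{J_n}]=(1-o(1))\,n^2\log n$ as $n\to\infty$, where $\log$ is the natural logarithm and $o(1)$ denotes a quantity that is nonnegative for all large $n$ and tends to $0$, uniformly over the choices of rounding and attachment. That is, for every $\varepsilon>0$ there is $N$ such that for all $n\ge N$ and every such graph $J_n$, $$(1-\varepsilon)\,n^2\log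 n\le \mathbb{E}[T_{J_n}]\le n^2\log n .$$ In particular, the general upper bound $n^2\log n+n$ for the expected time on connected graphs with $n$ vertices is asymptotically attained. -/

import Mathlib

open MeasureTheory ProbabilityTheory Filter
open scoped ENNReal unitInterval

noncomputable section

namespace EdgeConsensus

/-- The edge set of a (finite) graph is given the discrete σ-algebra. -/
instance edgeMeasurableSpace {V : Type*} (G : SimpleGraph V) : MeasurableSpace G.edgeSet := ⊤

open Classical in
/-- One interaction along the edge `e`: both endpoints of `e` adopt the higher of their two
strategies if `hi` is true and the lower one if `hi` is false; all other vertices are unchanged. -/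
def update {V : Type*} {m : ℕ} (e : Sym2 V) (hi : Bool) (x : V → Fin m) : V → Fin m :=
  fun v => if v ∈ e then (if hi then (e.map x).sup else (e.map x).inf) else x v

/-- All vertices have the same strategy. -/
def IsConsensus {V : Type*} {m : ℕ} (x : V → Fin m) : Prop :=
  ∀ u v, x u = x v

/-- A sample point: the starting strategies, and for each time step the edge that is chosen and the
coin which decides between the higher and the lower strategy. -/
abbrev Sample {V : Type*} (G : SimpleGraph V) (m : ℕ) : Type _ :=
  (V → Fin m) × (ℕ → G.edgeSet × Bool)

/-- The starting strategies are independent and uniform on `Fin m`; independently of them and of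
each other, at every time step the edge is uniform on the edge set and the coin is `true` with
probability `p`. -/
def sampleMeasure {V : Type*} [Fintype V] (G : SimpleGraph V) (m : ℕ) (p : I) :
    Measure (Sample G m) :=
  (Measure.pi fun _ : V => uniformOn (Set.univ : Set (Fin m))).prod
    (Measure.infinitePi fun _ : ℕ =>
      (uniformOn (Set.univ : Set G.edgeSet)).prod (bernoulliMeasure true false p))

/-- The strategies of the vertices after `t` time steps. -/
def state {V : Type*} {G : SimpleGraph V} {m : ℕ} (ω : Sample G m) : ℕ → V → Fin m
  | 0 => ω.1
  | t + 1 => update ((ω.2 t).1 : Sym2 V) (ω.2 t).2 (state ω t)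

/-- The first time at which all vertices have the same strategy (`⊤` if there is none). -/
def consensusTime {V : Type*} {G : SimpleGraph V} {m : ℕ} (ω : Sample G m) : ℕ∞ :=
  ⨅ (t : ℕ) (_ : IsConsensus (state ω t)), (t : ℕ∞)

/-- The expected time of the process with `m` strategies and parameter `p` on `G`. -/
def expectedTime {V : Type*} [Fintype V] (G : SimpleGraph V) (m : ℕ) (p : I) : ℝ≥0∞ :=
  ∫⁻ ω, (consensusTime ω : ℝ≥0∞) ∂(sampleMeasure G m p)

/-- The graph consisting of a clique on `Fin c` and `k` pendant paths with `l` vertices (outside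
the clique) each; the vertex `(i, 0)` of the `i`-th path is joined to the clique vertex `f i`. -/
def jellyfish (c k l : ℕ) (f : Fin k → Fin c) : SimpleGraph (Fin c ⊕ Fin k × Fin l) :=
  SimpleGraph.fromRel fun u v =>
    match u, v with
    | .inl _, .inl _ => True
    | .inl a, .inr (i, s) => a = f i ∧ s.val = 0
    | .inr _, .inl _ => False
    | .inr (i, s), .inr (j, t) => i = j ∧ t.val = s.val + 1

/-- The paths are attached as evenly as possible to the vertices of the clique: the numbers of paths
at any two vertices of the clique differ by at most one. -/
def IsBalanced {c k : ℕ} (f : Fin k → Fin c) : Prop :=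
  ∀ a b : Fin c, Nat.card {i // f i = a} ≤ Nat.card {i // f i = b} + 1

end EdgeConsensus

end

noncomputable section

namespace EdgeConsensus

/-! With `p = 0` the lower strategy spreads and never retreats, so the process is dual to a growing
set: after an interaction along `e` all vertices of `B` are high exactly when, before it, all
vertices of `absorb e B` were (`allHigh_update`). A random start makes a set of size `b` entirely
high with probability `2 ^ (-b)`. Let `M` be the number of edges and `q = 1 - 1 / (2 * M)`.

Upper bound. By connectedness some edge enlarges any proper nonempty `B`, which at least halves its
weight. So the probability that `B` is entirely high, minus that of the all-high state, is at most
`2 ^ (-|B|) * q ^ t` (`expectation_allHigh_sub_le`). Summing over single vertices and over time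
gives at most `2 * M * log n + M + 1` (`expectedTime_le`). The paths remove about `2 * n ^ 2 / log₂
n` from `2 * M`, and this absorbs the lower-order terms.

Lower bound. Seen from the end of a pendant path, the dual set is a tail of the path with exactly
one boundary edge until it reaches the clique, so the decay rate `q` is attained up to an error `2 ^
(-(l + 1))`. An edge enlarges at most one tail, and this lets the `k` paths be treated as if they
were independent (`sum_prod_add_ite_le`, `expectation_tailsHit_le`). Consensus needs all vertices
high or every path end low. At time about `(1 - ε / 2) * 2 * M * log n` a path end is still high
with probability at least about `n ^ (-(1 - ε / 2)) / 2`, and with `k = n / (log₂ n) ^ 2` paths some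
end is high with probability close to `1` (`measureReal_isConsensus_le`). -/

/-- The transition operator of the process with `p = 0`, acting on functions of the state. -/
def transition {V : Type*} {m : ℕ} (G : SimpleGraph V) [Fintype G.edgeSet]
    (g : (V → Fin m) → ℝ) (x : V → Fin m) : ℝ :=
  (∑ e : G.edgeSet, g (update (e : Sym2 V) false x)) / Fintype.card G.edgeSet

/-! ### The law of the state at a fixed time, through the transition operator. -/

section Law

variable {V : Type*} {m : ℕ} {G : SimpleGraph V}

lemma state_congr {x : V → Fin m} {η ζ : ℕ → G.edgeSet × Bool} {t : ℕ}
    (h : ∀ s < t, η s = ζ s) : state (x, η) t = state (x, ζ) t := by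
  induction t with
  | zero => rfl
  | succ t ih =>
    simp only [state]
    rw [ih fun s hs => h s (by omega), h t (by omega)]

instance : DiscreteMeasurableSpace G.edgeSet := ⟨fun _ => trivial⟩

lemma integral_uniformOn_univ {α : Type*} [Fintype α] [MeasurableSpace α]
    [DiscreteMeasurableSpace α] (g : α → ℝ) :
    ∫ a, g a ∂(uniformOn (Set.univ : Set α)) = (∑ a, g a) / Fintype.card α := by
  rcases isEmpty_or_nonempty α with h | h
  · simp [Measure.eq_zero_of_isEmpty]
  have := isProbabilityMeasure_uniformOn (Set.finite_univ (α := α)) Set.univ_nonempty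
  rw [integral_fintype (.of_finite), Finset.sum_div]
  refine Finset.sum_congr rfl fun a _ => ?_
  rw [measureReal_def, uniformOn_univ]
  simp [div_eq_inv_mul]

variable [Fintype V] [Fintype G.edgeSet]

/-- The law of one step of the process. -/
abbrev stepMeasure (G : SimpleGraph V) (p : I) : Measure (G.edgeSet × Bool) :=
  (uniformOn (Set.univ : Set G.edgeSet)).prod (bernoulliMeasure true false p)

lemma measurable_state_snd (x : V → Fin m) (t : ℕ) :
    Measurable fun η : ℕ → G.edgeSet × Bool => state (x, η) t := by
  induction t with
  | zero => exact measurable_const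
  | succ t ih =>
    have : Measurable fun z : (G.edgeSet × Bool) × (V → Fin m) =>
        update (z.1.1 : Sym2 V) z.1.2 z.2 := .of_discrete
    exact this.comp ((measurable_pi_apply t).prodMk ih)

lemma measurable_state (t : ℕ) : Measurable fun ω : Sample G m => state ω t :=
  measurable_from_prod_countable_right fun x => measurable_state_snd x t

/-- The average over all starting states of the expectation of `g` after `t` steps. -/
def expectation [DecidableEq V] (G : SimpleGraph V) [Fintype G.edgeSet] (t : ℕ) (g : (V → Fin m) → ℝ) : ℝ :=
  (∑ x, (transition G)^[t] g x) / m ^ Fintype.card V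

variable [Nonempty G.edgeSet]

instance : IsProbabilityMeasure (uniformOn (Set.univ : Set G.edgeSet)) :=
  isProbabilityMeasure_uniformOn Set.finite_univ Set.univ_nonempty

/-- The state at time `t` is a function of the choices before time `t`, and the choices are
independent. -/
lemma indepFun_state_eval (p : I) (x : V → Fin m) (t : ℕ) :
    IndepFun (fun η : ℕ → G.edgeSet × Bool => state (x, η) t) (fun η => η t)
      (Measure.infinitePi fun _ : ℕ => stepMeasure G p) := by
  classical
  have h := iIndepFun_infinitePi (P := fun _ : ℕ => stepMeasure G p)
    (X := fun _ (z : G.edgeSet × Bool) => z) (fun _ => measurable_id)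
  have h2 := h.indepFun_finset (Finset.range t) {t} (by simp)
    (fun i => (measurable_pi_apply i))
  obtain ⟨e₀⟩ := ‹Nonempty G.edgeSet›
  -- The value `(e₀, true)` is a filler for the times from `t` on, which do not influence the state
  -- at time `t`.
  let F : ((i : Finset.range t) → G.edgeSet × Bool) → (V → Fin m) := fun z =>
    state (x, fun s => if hs : s ∈ Finset.range t then z ⟨s, hs⟩ else (e₀, true)) t
  have h3 := h2.comp (φ := F)
    (ψ := fun z : ((i : ({t} : Finset ℕ)) → G.edgeSet × Bool) => z ⟨t, by simp⟩)
        .of_discrete .of_discrete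
  convert h3 using 1
  · funext η
    refine state_congr fun s hs => ?_
    simp [hs]
  · rfl

lemma integral_state_succ (x : V → Fin m) (t : ℕ) (g : (V → Fin m) → ℝ) :
    ∫ η, g (state (x, η) (t + 1)) ∂(Measure.infinitePi fun _ : ℕ => stepMeasure G 0) =
      ∫ η, transition G g (state (x, η) t)
        ∂(Measure.infinitePi fun _ : ℕ => stepMeasure G 0) := by
  set ρ := Measure.infinitePi fun _ : ℕ => stepMeasure G 0 with hρ
  have hm := measurable_state_snd (G := G) x t
  have he : Measurable fun η : ℕ → G.edgeSet × Bool => η t := measurable_pi_apply t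
  have hlaw := (indepFun_iff_map_prod_eq_prod_map_map hm.aemeasurable he.aemeasurable).1
    (indepFun_state_eval (G := G) 0 x t)
  let Φ : (V → Fin m) × (G.edgeSet × Bool) → ℝ := fun z => g (update (z.2.1 : Sym2 V) z.2.2 z.1)
  have hev : ρ.map (fun η => η t) = stepMeasure G 0 := Measure.infinitePi_map_eval _ t
  have h1 : ∫ η, g (state (x, η) (t + 1)) ∂ρ = ∫ z, Φ z ∂(ρ.map fun η => (state (x, η) t, η t)) := by
    rw [integral_map (hm.prodMk he).aemeasurable (Measurable.of_discrete).aestronglyMeasurable]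
    rfl
  rw [h1, hlaw]
  have : IsProbabilityMeasure (ρ.map fun η => state (x, η) t) :=
    Measure.isProbabilityMeasure_map hm.aemeasurable
  rw [hev, integral_prod _ (.of_finite), integral_map hm.aemeasurable
    (Measurable.of_discrete).aestronglyMeasurable]
  refine integral_congr_ae (.of_forall fun η => ?_)
  simp only [Φ]
  rw [integral_prod _ (.of_finite)]
  simp only [bernoulliMeasure_zero, integral_dirac]
  rw [integral_uniformOn_univ, transition]

lemma integral_state_snd (x : V → Fin m) (t : ℕ) (g : (V → Fin m) → ℝ) :
    ∫ η, g (state (x, η) t) ∂(Measure.infinitePi fun _ : ℕ => stepMeasure G 0) =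
      (transition G)^[t] g x := by
  induction t generalizing g with
  | zero => simp [state]
  | succ t ih => rw [integral_state_succ, ih, Function.iterate_succ_apply]

instance [NeZero m] : IsProbabilityMeasure (uniformOn (Set.univ : Set (Fin m))) :=
  isProbabilityMeasure_uniformOn Set.finite_univ Set.univ_nonempty

instance [NeZero m] (p : I) : IsProbabilityMeasure (sampleMeasure G m p) := by
  unfold sampleMeasure; infer_instance

lemma integrable_state [NeZero m] (t : ℕ) (g : (V → Fin m) → ℝ) :
    Integrable (fun ω : Sample G m => g (state ω t)) (sampleMeasure G m 0) := by
  obtain ⟨C, hC⟩ := (Set.finite_range g).isBounded.exists_norm_le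
  exact .of_bound ((Measurable.of_discrete (f := g)).comp
    (measurable_state t)).aestronglyMeasurable C (.of_forall fun ω => hC _ ⟨_, rfl⟩)

lemma integral_state [DecidableEq V] [NeZero m] (t : ℕ) (g : (V → Fin m) → ℝ) :
    ∫ ω, g (state ω t) ∂(sampleMeasure G m 0) = expectation G t g := by
  have hint := integrable_state (G := G) t g
  rw [sampleMeasure] at hint ⊢
  rw [integral_prod _ hint]
  have : ∀ x : V → Fin m, ∫ η, g (state (x, η) t) ∂(Measure.infinitePi fun _ : ℕ =>
    (uniformOn (Set.univ : Set G.edgeSet)).prod (bernoulliMeasure true false 0)) = _ :=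
    fun x => integral_state_snd x t g
  simp_rw [this]
  have hp : (Measure.pi fun _ : V => uniformOn (Set.univ : Set (Fin m))) =
      uniformOn (Set.univ : Set (V → Fin m)) := by
    rw [← uniformOn_pi, Set.pi_univ]
  rw [hp, integral_uniformOn_univ, expectation]
  simp

lemma measureReal_state [DecidableEq V] [NeZero m] (t : ℕ) (P : (V → Fin m) → Prop)
    [DecidablePred P] :
    (sampleMeasure G m 0).real {ω | P (state ω t)} =
      expectation G t fun x => if P x then 1 else 0 := by
  have hs : MeasurableSet {ω : Sample G m | P (state ω t)} :=
    measurable_state t (MeasurableSet.of_discrete (s := {x | P x}))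
  rw [← integral_state, ← integral_indicator_one hs]
  refine integral_congr_ae (.of_forall fun ω => ?_)
  by_cases h : P (state ω t) <;> simp [h]

lemma expectation_mono [DecidableEq V] [NeZero m] (t : ℕ) {g h : (V → Fin m) → ℝ} (hgh : g ≤ h) :
    expectation G t g ≤ expectation G t h := by
  rw [← integral_state, ← integral_state]
  exact integral_mono (integrable_state t g) (integrable_state t h) fun ω => hgh _

lemma expectation_sum [DecidableEq V] [NeZero m] {ι : Type*} (t : ℕ) (s : Finset ι)
    (g : ι → (V → Fin m) → ℝ) :
    expectation G t (fun x => ∑ i ∈ s, g i x) = ∑ i ∈ s, expectation G t (g i) := by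
  simp_rw [← integral_state]
  exact integral_finsetSum s fun i _ => integrable_state t (g i)

lemma expectation_add [DecidableEq V] [NeZero m] (t : ℕ) (g h : (V → Fin m) → ℝ) :
    expectation G t (fun x => g x + h x) = expectation G t g + expectation G t h := by
  simp_rw [← integral_state]
  exact integral_add (integrable_state t g) (integrable_state t h)

lemma expectation_sub [DecidableEq V] [NeZero m] (t : ℕ) (g h : (V → Fin m) → ℝ) :
    expectation G t (fun x => g x - h x) = expectation G t g - expectation G t h := by
  simp_rw [← integral_state]
  exact integral_sub (integrable_state t g) (integrable_state t h)

lemma expectation_div [DecidableEq V] [NeZero m] (t : ℕ) (g : (V → Fin m) → ℝ) (a : ℝ) :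
    expectation G t (fun x => g x / a) = expectation G t g / a := by
  simp_rw [← integral_state]
  exact integral_div a _

omit [Nonempty G.edgeSet] in
lemma expectation_succ [DecidableEq V] (t : ℕ) (g : (V → Fin m) → ℝ) :
    expectation G (t + 1) g = expectation G t (transition G g) := rfl

lemma expectation_succ_eq_sum [DecidableEq V] [NeZero m] (t : ℕ) (g : (V → Fin m) → ℝ) :
    expectation G (t + 1) g =
      (∑ e : G.edgeSet, expectation G t fun x => g (update (e : Sym2 V) false x)) /
        Fintype.card G.edgeSet := by
  rw [expectation_succ, ← expectation_sum, ← expectation_div]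
  rfl

end Law

/-! ### Bounds on the expected time through the probabilities of non-consensus. -/

section Time

variable {V : Type*} {m : ℕ} {G : SimpleGraph V}

lemma update_mk_false [DecidableEq V] (u v : V) (x : V → Fin m) (w : V) :
    update s(u, v) false x w = if w = u ∨ w = v then min (x u) (x v) else x w := by
  simp [update]

lemma IsConsensus.update {x : V → Fin m} (hx : IsConsensus x) (e : Sym2 V) (b : Bool) :
    IsConsensus (update e b x) := by
  have key : ∀ w, EdgeConsensus.update e b x w = x w := by
    intro w
    induction e with | _ u v
    cases b <;> simp [EdgeConsensus.update, hx u w, hx v w]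
  intro u v
  rw [key, key, hx u v]

lemma IsConsensus.state_of_le {ω : Sample G m} {s t : ℕ} (h : IsConsensus (state ω s))
    (hst : s ≤ t) : IsConsensus (state ω t) := by
  induction t, hst using Nat.le_induction with
  | base => exact h
  | succ t _ ih => exact ih.update _ _

lemma le_consensusTime {ω : Sample G m} {t : ℕ} (h : ¬ IsConsensus (state ω t)) :
    (t : ℕ∞) ≤ consensusTime ω :=
  le_iInf₂ fun s hs => by
    by_contra! hlt
    exact h (hs.state_of_le (by exact_mod_cast hlt.le))

open Classical in
lemma consensusTime_le_tsum (ω : Sample G m) :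
    (consensusTime ω : ℝ≥0∞) ≤ ∑' t, if IsConsensus (state ω t) then 0 else 1 := by
  by_cases h : ∃ t, IsConsensus (state ω t)
  · have h1 : consensusTime ω ≤ (Nat.find h : ℕ∞) :=
      iInf₂_le (f := fun (t : ℕ) (_ : IsConsensus (state ω t)) => (t : ℕ∞)) _ (Nat.find_spec h)
    calc (consensusTime ω : ℝ≥0∞) ≤ ((Nat.find h : ℕ∞) : ℝ≥0∞) := by exact_mod_cast h1
      _ = ∑ t ∈ Finset.range (Nat.find h), if IsConsensus (state ω t) then 0 else 1 := by
        rw [Finset.sum_congr rfl fun t ht =>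
          if_neg (Nat.find_min h (Finset.mem_range.1 ht))]
        simp
      _ ≤ _ := ENNReal.sum_le_tsum _
  · push Not at h
    simp [h]

variable [Fintype V] [Fintype G.edgeSet]

lemma measurableSet_not_isConsensus (t : ℕ) :
    MeasurableSet {ω : Sample G m | ¬ IsConsensus (state ω t)} :=
  measurable_state t (MeasurableSet.of_discrete (s := {x | ¬ IsConsensus x}))

lemma expectedTime_le_tsum (p : I) :
    expectedTime G m p ≤ ∑' t, sampleMeasure G m p {ω | ¬ IsConsensus (state ω t)} := by
  classical
  refine (lintegral_mono fun ω => consensusTime_le_tsum ω).trans_eq ?_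
  have : ∀ t, (fun ω : Sample G m => if IsConsensus (state ω t) then (0 : ℝ≥0∞) else 1) =
      {ω | ¬ IsConsensus (state ω t)}.indicator 1 := by
    intro t; ext ω; by_cases h : IsConsensus (state ω t) <;> simp [h]
  rw [lintegral_tsum]
  · refine tsum_congr fun t => ?_
    rw [this, lintegral_indicator_one (measurableSet_not_isConsensus t)]
  · intro t
    rw [this]
    exact (measurable_one.indicator (measurableSet_not_isConsensus t)).aemeasurable

/-- Markov's inequality, using that consensus is permanent. -/
lemma mul_measure_le_expectedTime (p : I) (t : ℕ) :
    t * sampleMeasure G m p {ω | ¬ IsConsensus (state ω t)} ≤ expectedTime G m p := by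
  rw [← lintegral_indicator_one (measurableSet_not_isConsensus t), expectedTime,
    ← lintegral_const_mul _ (measurable_one.indicator (measurableSet_not_isConsensus t))]
  refine lintegral_mono fun ω => ?_
  by_cases h : IsConsensus (state ω t)
  · simp [h]
  · have : ((t : ℕ∞) : ℝ≥0∞) ≤ consensusTime ω := by exact_mod_cast le_consensusTime h
    simpa [h] using this

end Time

/-! ### Duality with a growing set, and the upper bound for connected graphs. -/

section Duality

variable {V : Type*} [DecidableEq V]

/-- The indicator of the event that all vertices of `B` have the higher of two strategies. -/
def allHigh (B : Finset V) (x : V → Fin 2) : ℝ := if ∀ v ∈ B, x v = 1 then 1 else 0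

open Classical in
/-- The set `B`, enlarged by the endpoints of `e` if one of these lies in `B`. -/
def absorb (e : Sym2 V) (B : Finset V) : Finset V :=
  if ∃ v ∈ e, v ∈ B then B ∪ e.toFinset else B

lemma subset_absorb (e : Sym2 V) (B : Finset V) : B ⊆ absorb e B := by
  unfold absorb
  split_ifs
  · exact Finset.subset_union_left
  · exact subset_rfl

/-- The minimum of two strategies is high only if both are, so a set met by `e` needs both endpoints
of `e` high beforehand. -/
lemma allHigh_update (e : Sym2 V) (B : Finset V) (x : V → Fin 2) :
    allHigh B (update e false x) = allHigh (absorb e B) x := by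
  unfold allHigh
  congr 1
  induction e with | _ u v
  have hmin : ∀ a b : Fin 2, min a b = 1 ↔ a = 1 ∧ b = 1 := by decide
  simp only [update_mk_false, absorb, Sym2.mem_iff, eq_iff_iff]
  split_ifs with h
  · simp only [Finset.mem_union, Sym2.mem_toFinset, Sym2.mem_iff]
    constructor
    · intro H w hw
      obtain ⟨z, hz, hzB⟩ := h
      have h1 := H z hzB
      rw [if_pos (Sym2.mem_iff.1 hz), hmin] at h1
      rcases hw with hw | rfl | rfl
      · have h2 := H w hw
        split_ifs at h2 with h3
        · rcases h3 with rfl | rfl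
          exacts [h1.1, h1.2]
        · exact h2
      exacts [h1.1, h1.2]
    · intro H w hw
      split_ifs
      · rw [hmin]
        exact ⟨H _ (by simp), H _ (by simp)⟩
      · exact H _ (Or.inl hw)
  · push Not at h
    refine forall₂_congr fun w hw => ?_
    rw [if_neg fun h' => h w (Sym2.mem_iff.2 h') hw]

variable [Fintype V]

lemma sum_prod_apply {W α : Type*} [Fintype W] [DecidableEq W] [Fintype α] (φ : W → α → ℝ) :
    ∑ x : W → α, ∏ w, φ w (x w) = ∏ w, ∑ a, φ w a := by
  rw [Finset.prod_univ_sum, Fintype.piFinset_univ]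

lemma sum_allHigh (B : Finset V) :
    ∑ x : V → Fin 2, allHigh B x = 2 ^ Fintype.card V * (1 / 2) ^ B.card := by
  have h1 : ∀ x : V → Fin 2, allHigh B x = ∏ w, if w ∈ B ∧ x w = 0 then (0 : ℝ) else 1 := by
    intro x
    have h01 : ∀ a : Fin 2, a = 1 ↔ a ≠ 0 := by decide
    unfold allHigh
    split_ifs with h
    · exact (Finset.prod_eq_one fun w _ => if_neg fun h' => (h01 _).1 (h w h'.1) h'.2).symm
    · push Not at h
      obtain ⟨w, hw, hx⟩ := h
      have h0 : x w = 0 := by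
        by_contra h0
        exact hx ((h01 _).2 h0)
      symm
      refine Finset.prod_eq_zero (Finset.mem_univ w) ?_
      simp [hw, h0]
  simp_rw [h1]
  rw [sum_prod_apply (W := V) (α := Fin 2) fun w a => if w ∈ B ∧ a = 0 then (0 : ℝ) else 1]
  have h2 : ∀ w, (∑ a : Fin 2, if w ∈ B ∧ a = 0 then (0 : ℝ) else 1) =
      2 * if w ∈ B then 1 / 2 else 1 := by
    intro w
    by_cases h : w ∈ B <;> simp [h]
  simp_rw [h2]
  rw [Finset.prod_mul_distrib]
  simp

lemma allHigh_univ_update (e : Sym2 V) (x : V → Fin 2) :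
    allHigh Finset.univ (update e false x) = allHigh Finset.univ x := by
  rw [allHigh_update, Finset.univ_subset_iff.1 (subset_absorb e Finset.univ)]

variable {G : SimpleGraph V} [Fintype G.edgeSet]

lemma expectation_zero (g : (V → Fin 2) → ℝ) :
    expectation G 0 g = (∑ x, g x) / 2 ^ Fintype.card V := by
  simp [expectation]

lemma expectation_zero_allHigh (B : Finset V) :
    expectation G 0 (allHigh B) = (1 / 2) ^ B.card := by
  rw [expectation_zero, sum_allHigh]
  field_simp

variable [Nonempty G.edgeSet]

lemma expectation_allHigh_univ (t : ℕ) :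
    expectation G t (allHigh Finset.univ) = (1 / 2) ^ Fintype.card V := by
  induction t with
  | zero => rw [expectation_zero_allHigh, Finset.card_univ]
  | succ t ih =>
    rw [expectation_succ_eq_sum]
    simp_rw [allHigh_univ_update]
    have : (Fintype.card G.edgeSet : ℝ) ≠ 0 := by positivity
    change (∑ e : G.edgeSet, expectation G t (allHigh Finset.univ)) / _ = _
    rw [ih, Finset.sum_const, Finset.card_univ, nsmul_eq_mul, mul_div_cancel_left₀ _ this]

/-- The factor by which the probability that a set of vertices has not been reached decreases. -/
def decayRate (G : SimpleGraph V) [Fintype G.edgeSet] : ℝ := 1 - 1 / (2 * Fintype.card G.edgeSet)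

omit [DecidableEq V] [Fintype V] in
lemma decayRate_nonneg : 0 ≤ decayRate G := by
  have : (1 : ℝ) ≤ Fintype.card G.edgeSet := by exact_mod_cast Fintype.card_pos
  rw [decayRate, sub_nonneg, div_le_one (by positivity)]
  linarith

/-- Condition on the first edge of the dual process. At least one of the `M` edges enlarges `B` and
gains a factor `1 / 2`, the others lose nothing; the average factor is at most `1 - 1 / M + 1 / (2 *
M) = q`. Subtracting the invariant all-high event makes the case `B = univ` trivial. -/
lemma expectation_allHigh_sub_le
    (hG : ∀ B : Finset V, B.Nonempty → B ≠ Finset.univ →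
      ∃ e : G.edgeSet, B.card < (absorb (e : Sym2 V) B).card)
    (t : ℕ) {B : Finset V} (hB : B.Nonempty) :
    expectation G t (fun x => allHigh B x - allHigh Finset.univ x) ≤
      (1 / 2) ^ B.card * decayRate G ^ t := by
  have hq := decayRate_nonneg (G := G)
  have hM : (1 : ℝ) ≤ Fintype.card G.edgeSet := by exact_mod_cast Fintype.card_pos
  induction t generalizing B with
  | zero =>
    rw [expectation_sub, expectation_zero_allHigh, expectation_allHigh_univ]
    simp
  | succ t ih =>
    rw [expectation_succ_eq_sum]
    simp_rw [allHigh_univ_update, allHigh_update]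
    rcases eq_or_ne B Finset.univ with rfl | hne
    · simp_rw [Finset.univ_subset_iff.1 (subset_absorb _ Finset.univ), sub_self]
      have h0 : expectation G t (fun _ : V → Fin 2 => (0 : ℝ)) = 0 := by
        simpa using expectation_sum (G := G) t (∅ : Finset Unit) (fun _ (_ : V → Fin 2) => (0 : ℝ))
      rw [h0]
      simp only [Finset.sum_const_zero, zero_div]
      positivity
    · obtain ⟨e₀, he₀⟩ := hG B hB hne
      rw [div_le_iff₀ (by positivity), ← Finset.add_sum_erase _ _ (Finset.mem_univ e₀)]
      have hmono : ∀ e : G.edgeSet, ∀ j ≤ (absorb (e : Sym2 V) B).card,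
          expectation G t (fun x => allHigh (absorb (e : Sym2 V) B) x - allHigh Finset.univ x) ≤
            (1 / 2) ^ j * decayRate G ^ t := fun e j hj =>
        (ih (hB.mono (subset_absorb _ _))).trans <| mul_le_mul_of_nonneg_right
          (pow_le_pow_of_le_one (by norm_num) (by norm_num) hj) (by positivity)
      refine (add_le_add (hmono e₀ (B.card + 1) he₀) (Finset.sum_le_sum fun e _ =>
        hmono e B.card (Finset.card_le_card (subset_absorb _ _)))).trans_eq ?_
      rw [Finset.sum_const, Finset.card_erase_of_mem (Finset.mem_univ _), Finset.card_univ,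
        nsmul_eq_mul, Nat.cast_sub Fintype.card_pos]
      have hr : decayRate G * Fintype.card G.edgeSet = Fintype.card G.edgeSet - 1 / 2 := by
        rw [decayRate]
        field_simp
      calc _ = (1 / 2) ^ B.card * decayRate G ^ t * (Fintype.card G.edgeSet - 1 / 2) := by
            push_cast
            ring
        _ = _ := by rw [← hr]; ring

-- Without consensus some vertex is high while not all are: a union bound over that vertex.
open Classical in
lemma not_isConsensus_le_sum_allHigh (x : V → Fin 2) :
    (if ¬ IsConsensus x then (1 : ℝ) else 0) ≤
      ∑ v, (allHigh {v} x - allHigh Finset.univ x) := by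
  have hnn : ∀ v, 0 ≤ allHigh {v} x - allHigh Finset.univ x := by
    intro v
    unfold allHigh
    split_ifs with h1 h2 <;> simp_all
  split_ifs with h
  · exact Finset.sum_nonneg fun v _ => hnn v
  · have h' : ∃ u v, x u ≠ x v := by simpa [IsConsensus] using h
    obtain ⟨w, z, hw, hz⟩ : ∃ w z, x w = 1 ∧ x z ≠ 1 := by
      obtain ⟨u, v, huv⟩ := h'
      by_cases hu : x u = 1
      · exact ⟨u, v, hu, fun h => huv (hu.trans h.symm)⟩
      · refine ⟨v, u, ?_, hu⟩
        have : ∀ a b : Fin 2, a ≠ b → a ≠ 1 → b = 1 := by decide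
        exact this _ _ huv hu
    refine le_trans ?_ (Finset.single_le_sum (fun v _ => hnn v) (Finset.mem_univ w))
    have : ¬ ∀ v, x v = 1 := fun H => hz (H z)
    simp [allHigh, hw, this]

lemma measureReal_not_isConsensus_le
    (hG : ∀ B : Finset V, B.Nonempty → B ≠ Finset.univ →
      ∃ e : G.edgeSet, B.card < (absorb (e : Sym2 V) B).card) (t : ℕ) :
    (sampleMeasure G 2 0).real {ω | ¬ IsConsensus (state ω t)} ≤
      Fintype.card V / 2 * decayRate G ^ t := by
  classical
  rw [measureReal_state (P := fun x => ¬ IsConsensus x)]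
  refine (expectation_mono t not_isConsensus_le_sum_allHigh).trans ?_
  rw [expectation_sum]
  refine (Finset.sum_le_sum fun v _ =>
    expectation_allHigh_sub_le hG t (Finset.singleton_nonempty v)).trans_eq ?_
  simp
  ring

lemma expectedTime_le
    (hG : ∀ B : Finset V, B.Nonempty → B ≠ Finset.univ →
      ∃ e : G.edgeSet, B.card < (absorb (e : Sym2 V) B).card) [Nonempty V] :
    expectedTime G 2 0 ≤ ENNReal.ofReal
      (2 * Fintype.card G.edgeSet * Real.log (Fintype.card V) + Fintype.card G.edgeSet + 1) := by
  set M := (Fintype.card G.edgeSet : ℝ) with hMdef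
  set n := (Fintype.card V : ℝ) with hn
  have hM : (1 : ℝ) ≤ M := Nat.one_le_cast.2 Fintype.card_pos
  have hn1 : (1 : ℝ) ≤ n := Nat.one_le_cast.2 Fintype.card_pos
  -- Up to time `N` probabilities are bounded by `1`. From then on `q ^ N ≤ 1 / n` cancels the
  -- factor `n` of the union bound, and the remaining geometric series sums to `M`.
  set N := ⌈2 * M * Real.log n⌉₊ with hN
  set q := decayRate G with hqdef
  have hq := decayRate_nonneg (G := G)
  have hq1 : q < 1 := by
    have : 0 < 1 / (2 * M) := by positivity
    rw [hqdef, decayRate]; linarith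
  have hqN : q ^ N ≤ 1 / n := by
    calc q ^ N ≤ Real.exp (-(1 / (2 * M))) ^ N := by
          gcongr
          have := Real.add_one_le_exp (-(1 / (2 * M)))
          rw [hqdef, decayRate]; linarith
      _ = Real.exp (-(N / (2 * M))) := by rw [← Real.exp_nat_mul]; ring_nf
      _ ≤ Real.exp (-Real.log n) := by
          gcongr
          rw [le_div_iff₀ (by positivity)]
          have := Nat.le_ceil (2 * M * Real.log n)
          linarith
      _ = 1 / n := by rw [Real.exp_neg, Real.exp_log (by positivity), one_div]
  have hbound : ∀ t, sampleMeasure G 2 0 {ω | ¬ IsConsensus (state ω (t + N))} ≤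
      ENNReal.ofReal (1 / 2 * q ^ t) := by
    intro t
    refine (ENNReal.le_ofReal_iff_toReal_le (measure_ne_top _ _) (by positivity)).2 ?_
    refine (measureReal_not_isConsensus_le hG (t + N)).trans ?_
    calc n / 2 * q ^ (t + N) = n / 2 * q ^ t * q ^ N := by ring
      _ ≤ n / 2 * q ^ t * (1 / n) := by gcongr
      _ = 1 / 2 * q ^ t := by field_simp
  calc expectedTime G 2 0
      ≤ ∑' t, sampleMeasure G 2 0 {ω | ¬ IsConsensus (state ω t)} := expectedTime_le_tsum 0
    _ = ∑ t ∈ Finset.range N, sampleMeasure G 2 0 {ω | ¬ IsConsensus (state ω t)} +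
        ∑' t, sampleMeasure G 2 0 {ω | ¬ IsConsensus (state ω (t + N))} :=
        (ENNReal.summable.sum_add_tsum_nat_add' (k := N)).symm
    _ ≤ ∑ t ∈ Finset.range N, 1 + ∑' t, ENNReal.ofReal (1 / 2 * q ^ t) :=
        add_le_add (Finset.sum_le_sum fun t _ => prob_le_one) (ENNReal.tsum_le_tsum hbound)
    _ = ENNReal.ofReal (N + M) := by
        have hs := (hasSum_geometric_of_lt_one hq hq1).mul_left (1 / 2)
        rw [← ENNReal.ofReal_tsum_of_nonneg (fun t => by positivity) hs.summable, hs.tsum_eq,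
          ENNReal.ofReal_add (by positivity) (by positivity)]
        have : 1 / 2 * (1 - q)⁻¹ = M := by
          rw [hqdef, decayRate]; field_simp; ring
        rw [this]
        simp
    _ ≤ _ := by
        refine ENNReal.ofReal_le_ofReal ?_
        have := Nat.ceil_lt_add_one (a := 2 * M * Real.log n)
          (mul_nonneg (by positivity) (Real.log_nonneg hn1))
        linarith

end Duality

/-! ### A product inequality replacing independence. -/

lemma one_add_sum_le_prod_one_add {ι : Type*} (s : Finset ι) {z : ι → ℝ} (hz : ∀ i, 0 ≤ z i) :
    1 + ∑ i ∈ s, z i ≤ ∏ i ∈ s, (1 + z i) := by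
  classical
  induction s using Finset.induction_on with
  | empty => simp
  | insert a s ha ih =>
    rw [Finset.sum_insert ha, Finset.prod_insert ha]
    nlinarith [hz a, mul_le_mul_of_nonneg_left ih (add_nonneg zero_le_one (hz a)),
      mul_nonneg (hz a) (Finset.sum_nonneg fun i (_ : i ∈ s) => hz i)]

/-- If each `e` raises at most one factor and each factor is raised by at most one `e`, averaging
over `e` gives at most the product of the averaged factors. After division by `∏ y i` this is `1 + ∑
z i ≤ ∏ (1 + z i)`. -/
lemma sum_prod_add_ite_le {ε ι : Type*} [Fintype ε] [Nonempty ε] [Fintype ι]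
    (r : ε → ι → Prop) [∀ e i, Decidable (r e i)]
    (hr : ∀ e i j, r e i → r e j → i = j) (hr' : ∀ i e e', r e i → r e' i → e = e')
    {y δ : ι → ℝ} (hy : ∀ i, 0 < y i) (hδ : ∀ i, 0 ≤ δ i) :
    ∑ e, ∏ i, (y i + if r e i then δ i else 0) ≤
      Fintype.card ε * ∏ i, (y i + δ i / Fintype.card ε) := by
  classical
  set N := (Fintype.card ε : ℝ)
  have hN : 0 < N := Nat.cast_pos.2 Fintype.card_pos
  have hz : ∀ i, 0 ≤ δ i / y i := fun i => div_nonneg (hδ i) (hy i).le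
  have h1 : ∀ e, ∏ i, (y i + if r e i then δ i else 0) =
      (∏ i, y i) * (1 + ∑ i, if r e i then δ i / y i else 0) := by
    intro e
    have : ∀ i, (y i + if r e i then δ i else 0) =
        y i * (1 + if r e i then δ i / y i else 0) := by
      intro i
      have := (hy i).ne'
      split_ifs
      · field_simp
      · ring
    simp_rw [this]
    rw [Finset.prod_mul_distrib]
    congr 1
    by_cases h : ∃ i, r e i
    · obtain ⟨i, hi⟩ := h
      have hne : ∀ j, j ≠ i → ¬ r e j := fun j hj hj' => hj (hr e j i hj' hi)
      rw [Finset.prod_eq_single i (fun j _ hj => by simp [hne j hj]) (by simp),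
        Finset.sum_eq_single i (fun j _ hj => by simp [hne j hj]) (by simp)]
    · push Not at h
      simp [h]
  have h2 : ∑ e, (1 + ∑ i, if r e i then δ i / y i else 0) ≤ N + ∑ i, δ i / y i := by
    rw [Finset.sum_add_distrib, Finset.sum_comm]
    refine add_le_add (by simp [N]) (Finset.sum_le_sum fun i _ => ?_)
    by_cases h : ∃ e, r e i
    · obtain ⟨e, he⟩ := h
      rw [Finset.sum_eq_single e (fun e' _ he' => if_neg fun h' => he' (hr' i e' e h' he))
        (by simp)]
      simp [he]
    · push Not at h
      simp [h, hz i]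
  simp_rw [h1]
  rw [← Finset.mul_sum]
  have h3 : N + ∑ i, δ i / y i ≤ N * ∏ i, (1 + δ i / y i / N) := by
    refine le_trans (le_of_eq ?_) (mul_le_mul_of_nonneg_left
      (one_add_sum_le_prod_one_add Finset.univ fun i => div_nonneg (hz i) hN.le) hN.le)
    rw [← Finset.sum_div]
    field_simp
  calc _ ≤ (∏ i, y i) * (N * ∏ i, (1 + δ i / y i / N)) :=
        mul_le_mul_of_nonneg_left (h2.trans h3) (Finset.prod_nonneg fun i _ => (hy i).le)
    _ = N * ∏ i, (y i + δ i / N) := by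
        rw [mul_left_comm, ← Finset.prod_mul_distrib]
        congr 1
        refine Finset.prod_congr rfl fun i _ => ?_
        have := (hy i).ne'
        field_simp

/-! ### Boundary edges, and independence of the starting strategies on disjoint sets. -/

section

variable {V : Type*} [DecidableEq V]

/-- The edge `e` has one endpoint in `B` and one outside. -/
def Crosses (e : Sym2 V) (B : Finset V) : Prop := (∃ v ∈ e, v ∈ B) ∧ ∃ v ∈ e, v ∉ B

lemma absorb_eq_self {e : Sym2 V} {B : Finset V} (h : ¬ Crosses e B) : absorb e B = B := by
  unfold absorb
  split_ifs with h1
  · refine Finset.union_eq_left.2 fun v hv => ?_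
    by_contra hvB
    exact h ⟨h1, v, by simpa using hv, hvB⟩
  · rfl

omit [DecidableEq V] in
lemma allHigh_nonneg (B : Finset V) (x : V → Fin 2) : 0 ≤ allHigh B x := by
  unfold allHigh; split_ifs <;> norm_num

omit [DecidableEq V] in
lemma allHigh_le_one (B : Finset V) (x : V → Fin 2) : allHigh B x ≤ 1 := by
  unfold allHigh; split_ifs <;> norm_num

omit [DecidableEq V] in
lemma allHigh_anti {B C : Finset V} (h : B ⊆ C) (x : V → Fin 2) : allHigh C x ≤ allHigh B x := by
  unfold allHigh
  split_ifs with h1 h2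
  · rfl
  · exact absurd (fun v hv => h1 v (h hv)) h2
  · norm_num
  · rfl

lemma allHigh_mul (B C : Finset V) (x : V → Fin 2) :
    allHigh B x * allHigh C x = allHigh (B ∪ C) x := by
  unfold allHigh
  simp only [Finset.mem_union, or_imp, forall_and]
  split_ifs <;> simp_all

/-- The extra set `C` carries the induction: expanding one factor `1 - allHigh (B a)` moves `B a`
into `C`. -/
lemma expectation_zero_prod [Fintype V] {G : SimpleGraph V} [Fintype G.edgeSet]
    [Nonempty G.edgeSet] {ι : Type*} (S : Finset ι)
    (B : ι → Finset V) (hB : ∀ i j, i ≠ j → Disjoint (B i) (B j)) {C : Finset V}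
    (hC : ∀ i ∈ S, Disjoint C (B i)) :
    expectation G 0 (fun x => (∏ i ∈ S, (1 - allHigh (B i) x)) * allHigh C x) =
      (∏ i ∈ S, (1 - (1 / 2 : ℝ) ^ (B i).card)) * (1 / 2) ^ C.card := by
  classical
  induction S using Finset.induction_on generalizing C with
  | empty =>
    simp only [Finset.prod_empty, one_mul]
    exact expectation_zero_allHigh C
  | insert a S ha ih =>
    have h1 : ∀ x, (∏ i ∈ insert a S, (1 - allHigh (B i) x)) * allHigh C x =
        (∏ i ∈ S, (1 - allHigh (B i) x)) * allHigh C x -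
          (∏ i ∈ S, (1 - allHigh (B i) x)) * allHigh (C ∪ B a) x := by
      intro x
      rw [Finset.prod_insert ha, ← allHigh_mul]
      ring
    simp_rw [h1]
    rw [expectation_sub, ih fun i hi => hC i (Finset.mem_insert_of_mem hi), ih,
      Finset.card_union_of_disjoint (hC a (Finset.mem_insert_self _ _)), Finset.prod_insert ha]
    · ring
    · intro i hi
      refine Finset.disjoint_union_left.2 ⟨hC i (Finset.mem_insert_of_mem hi), hB _ _ ?_⟩
      rintro rfl
      exact ha hi

end

/-! ### Tails of the pendant paths, and the bound on the probability of consensus. -/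

section Jellyfish

variable {c k l : ℕ} (f : Fin k → Fin c)

/-- The next vertex on the way from a vertex of a pendant path to the clique. -/
def parent (p : Fin k × Fin l) : Fin c ⊕ Fin k × Fin l :=
  if p.2.val = 0 then .inl (f p.1) else .inr (p.1, ⟨p.2 - 1, by omega⟩)

lemma fst_eq_of_parent_eq_inr {p p' : Fin k × Fin l} (h : parent f p = .inr p') :
    p'.1 = p.1 := by
  unfold parent at h
  split_ifs at h
  rw [← Sum.inr.inj h]

lemma adj_parent (p : Fin k × Fin l) : (jellyfish c k l f).Adj (parent f p) (.inr p) := by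
  obtain ⟨i, s⟩ := p
  unfold parent
  rw [jellyfish, SimpleGraph.fromRel_adj]
  split_ifs with h
  · simpa using h
  · simp only at h ⊢
    refine ⟨fun h' => ?_, Or.inl ?_⟩
    · have := congrArg Fin.val (Prod.ext_iff.1 (Sum.inr.inj h')).2
      simp only at this
      omega
    · simp only [true_and]
      omega

lemma adj_inl {a b : Fin c} (h : a ≠ b) : (jellyfish c k l f).Adj (.inl a) (.inl b) := by
  rw [jellyfish, SimpleGraph.fromRel_adj]
  simp [h]

lemma mem_edgeSet_cases {e : Sym2 (Fin c ⊕ Fin k × Fin l)} (he : e ∈ (jellyfish c k l f).edgeSet) :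
    (∃ a b : Fin c, a ≠ b ∧ e = s(.inl a, .inl b)) ∨ ∃ p, e = s(parent f p, .inr p) := by
  have key : ∀ (i : Fin k) (s : Fin l) (j : Fin k) (t : Fin l), i = j ∧ t.val = s.val + 1 →
      (Sum.inr (i, s) : Fin c ⊕ Fin k × Fin l) = parent f (j, t) := by
    rintro i s _ t ⟨rfl, h⟩
    rw [parent, if_neg (by simp [h])]
    simp [h]
  have key' : ∀ (a : Fin c) (j : Fin k) (t : Fin l), a = f j ∧ t.val = 0 →
      (Sum.inl a : Fin c ⊕ Fin k × Fin l) = parent f (j, t) := by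
    rintro _ j t ⟨rfl, h⟩
    rw [parent, if_pos h]
  induction e with | _ u v
  rw [SimpleGraph.mem_edgeSet, jellyfish, SimpleGraph.fromRel_adj] at he
  obtain ⟨hne, h⟩ := he
  rcases u with a | ⟨i, s⟩ <;> rcases v with b | ⟨j, t⟩ <;> simp only [or_false, false_or] at h
  · exact Or.inl ⟨a, b, fun h => hne (by rw [h]), rfl⟩
  · exact Or.inr ⟨(j, t), by rw [key' a j t h]⟩
  · exact Or.inr ⟨(i, s), by rw [key' b i s h, Sym2.eq_swap]⟩
  · rcases h with h | h
    · exact Or.inr ⟨(j, t), by rw [key i s j t h]⟩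
    · exact Or.inr ⟨(i, s), by rw [key j t i s h, Sym2.eq_swap]⟩

/-- The last `m` vertices of the `i`-th pendant path. -/
def pathTail (c : ℕ) (i : Fin k) (l m : ℕ) : Finset (Fin c ⊕ Fin k × Fin l) :=
  (Finset.univ.filter fun s : Fin l => l ≤ s + m).image fun s => .inr (i, s)

lemma inl_notMem_pathTail (a : Fin c) (i : Fin k) (m : ℕ) : .inl a ∉ pathTail c i l m := by
  simp [pathTail]

lemma inr_mem_pathTail {i : Fin k} {m : ℕ} {p : Fin k × Fin l} :
    .inr p ∈ pathTail c i l m ↔ p.1 = i ∧ l ≤ p.2 + m := by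
  obtain ⟨j, s⟩ := p
  simp only [pathTail, Finset.mem_image, Finset.mem_filter, Finset.mem_univ, true_and,
    Sum.inr.injEq, Prod.mk.injEq]
  constructor
  · rintro ⟨s, h, rfl, rfl⟩
    exact ⟨rfl, h⟩
  · rintro ⟨rfl, h⟩
    exact ⟨s, h, rfl, rfl⟩

lemma parent_mem_pathTail {i : Fin k} {m : ℕ} {p : Fin k × Fin l} :
    parent f p ∈ pathTail c i l m ↔ p.1 = i ∧ l + 1 ≤ p.2 + m ∧ p.2.val ≠ 0 := by
  unfold parent
  split_ifs with h
  · simp [inl_notMem_pathTail, h]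
  · rw [inr_mem_pathTail]
    simp only
    omega

lemma card_pathTail_le (i : Fin k) (m : ℕ) : (pathTail c i l m).card ≤ m := by
  refine Finset.card_image_le.trans ?_
  have : (Finset.univ.filter fun s : Fin l => l ≤ s + m).card ≤ (Finset.range m).card :=
    Finset.card_le_card_of_injOn (fun s => l - 1 - s)
      (fun s hs => by
        have := s.2
        simp only [Finset.coe_filter, Finset.mem_univ, true_and, Set.mem_ofPred_eq] at hs
        simp only [Finset.coe_range, Set.mem_Iio]
        omega)
      (fun s _ t _ h => by
        have := s.2
        have := t.2
        simp only at h
        ext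
        omega)
  simpa using this

lemma disjoint_pathTail {i j : Fin k} (h : i ≠ j) (m m' : ℕ) :
    Disjoint (pathTail c i l m) (pathTail c j l m') := by
  rw [Finset.disjoint_left]
  rintro (a | p) h1 h2
  · exact inl_notMem_pathTail _ _ _ h1
  · exact h ((inr_mem_pathTail.1 h1).1.symm.trans (inr_mem_pathTail.1 h2).1)

/-- A tail avoids the clique, so the edge from its innermost vertex towards the clique is its only
boundary edge. -/
lemma Crosses.exists_eq {e : Sym2 (Fin c ⊕ Fin k × Fin l)}
    (he : e ∈ (jellyfish c k l f).edgeSet) {i : Fin k} {m : ℕ} (hm : m ≤ l)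
    (h : Crosses e (pathTail c i l m)) :
    ∃ p : Fin k × Fin l, p.1 = i ∧ p.2 + m = l ∧ e = s(parent f p, .inr p) := by
  obtain ⟨⟨u, hu, hu'⟩, v, hv, hv'⟩ := h
  rcases mem_edgeSet_cases f he with ⟨a, b, -, rfl⟩ | ⟨p, rfl⟩
  · rcases Sym2.mem_iff.1 hu with rfl | rfl <;> exact absurd hu' (inl_notMem_pathTail _ _ _)
  · refine ⟨p, ?_⟩
    rcases Sym2.mem_iff.1 hu with rfl | rfl <;> rcases Sym2.mem_iff.1 hv with rfl | rfl <;>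
      simp only [parent_mem_pathTail, inr_mem_pathTail] at hu' hv' <;>
      refine ⟨by tauto, by omega, rfl⟩

lemma absorb_pathTail_subset {e : Sym2 (Fin c ⊕ Fin k × Fin l)}
    (he : e ∈ (jellyfish c k l f).edgeSet) {i : Fin k} {m : ℕ} (hm : m < l) :
    absorb e (pathTail c i l m) ⊆ pathTail c i l (m + 1) := by
  have hsub : pathTail c i l m ⊆ pathTail c i l (m + 1) := by
    rintro (a | p) h
    · exact absurd h (inl_notMem_pathTail _ _ _)
    · rw [inr_mem_pathTail] at h ⊢
      exact ⟨h.1, by omega⟩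
  by_cases h : Crosses e (pathTail c i l m)
  · obtain ⟨p, hp, hpm, rfl⟩ := h.exists_eq f he hm.le
    unfold absorb
    rw [if_pos h.1]
    refine Finset.union_subset hsub fun v hv => ?_
    simp only [Sym2.mem_toFinset, Sym2.mem_iff] at hv
    rcases hv with rfl | rfl
    · rw [parent_mem_pathTail]
      exact ⟨hp, by omega, by omega⟩
    · rw [inr_mem_pathTail]
      exact ⟨hp, by omega⟩
  · rwa [absorb_eq_self h]

/-- The indicator of the event that for every path with `D i ≤ l` one of the last `D i` vertices
has the lower strategy. -/
def tailsHit (c l : ℕ) {k : ℕ} (D : Fin k → ℕ) (x : Fin c ⊕ Fin k × Fin l → Fin 2) : ℝ :=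
  ∏ i, if D i ≤ l then 1 - allHigh (pathTail c i l (D i)) x else 1

-- Duality for tails: one interaction lengthens a tail by at most one vertex. When the full path (`D
-- i = l`) is crossed, `D i` becomes `l + 1` and the factor is replaced by the trivial bound `1`.
open Classical in
lemma tailsHit_update_le {e : Sym2 (Fin c ⊕ Fin k × Fin l)}
    (he : e ∈ (jellyfish c k l f).edgeSet) (D : Fin k → ℕ) (x : Fin c ⊕ Fin k × Fin l → Fin 2) :
    tailsHit c l D (update e false x) ≤
      tailsHit c l (fun i => D i + if D i ≤ l ∧ Crosses e (pathTail c i l (D i)) then 1 else 0) x := by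
  refine Finset.prod_le_prod (fun i _ => ?_) fun i _ => ?_
  · split_ifs
    · exact sub_nonneg.2 (allHigh_le_one _ _)
    · exact zero_le_one
  · rw [allHigh_update]
    by_cases h1 : D i ≤ l
    · by_cases h2 : Crosses e (pathTail c i l (D i))
      · simp only [h1, h2, and_self, if_true]
        split_ifs with h3
        · exact sub_le_sub_left (allHigh_anti (absorb_pathTail_subset f he h3) x) 1
        · exact sub_le_self _ (allHigh_nonneg _ _)
      · simp [h1, h2, absorb_eq_self h2]
    · simp [h1]

variable {f} [Fintype (jellyfish c k l f).edgeSet] [Nonempty (jellyfish c k l f).edgeSet]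

/-- The right-hand side is what independent paths would give. The correction `(1 / 2) ^ (l + 1)`
pays for stopping the dual process at the clique: it makes the factor at least `1` when `D i = l +
1`. -/
lemma expectation_tailsHit_le (t : ℕ) (D : Fin k → ℕ) (hD : ∀ i, D i ≤ l + 1) :
    expectation (jellyfish c k l f) t (tailsHit c l D) ≤
      ∏ i, (1 - ((1 / 2) ^ D i * decayRate (jellyfish c k l f) ^ t - (1 / 2) ^ (l + 1))) := by
  classical
  set q := decayRate (jellyfish c k l f) with hqdef
  have hq : 0 ≤ q := decayRate_nonneg
  have hM : (1 : ℝ) ≤ Fintype.card (jellyfish c k l f).edgeSet :=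
    Nat.one_le_cast.2 Fintype.card_pos
  have hq1 : q ≤ 1 := by
    have : 0 ≤ 1 / (2 * (Fintype.card (jellyfish c k l f).edgeSet : ℝ)) := by positivity
    rw [hqdef, decayRate]; linarith
  induction t generalizing D with
  | zero =>
    have h1 : tailsHit c l D = fun x => (∏ i ∈ Finset.univ.filter fun i => D i ≤ l,
        (1 - allHigh (pathTail c i l (D i)) x)) * allHigh ∅ x := by
      funext x
      rw [tailsHit, Finset.prod_filter]
      simp [allHigh]
    rw [h1, expectation_zero_prod _ _ (fun i j hij => disjoint_pathTail hij _ _) (by simp),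
      Finset.prod_filter]
    simp only [Finset.card_empty, pow_zero, mul_one]
    refine Finset.prod_le_prod (fun i _ => ?_) fun i _ => ?_
    · split_ifs
      · exact sub_nonneg.2 (pow_le_one₀ (by norm_num) (by norm_num))
      · exact zero_le_one
    · have h2 : (0 : ℝ) ≤ (1 / 2) ^ (l + 1) := by positivity
      split_ifs with h
      · have : (1 / 2 : ℝ) ^ D i ≤ (1 / 2) ^ (pathTail c i l (D i)).card :=
          pow_le_pow_of_le_one (by norm_num) (by norm_num) (card_pathTail_le i (D i))
        linarith
      · have : D i = l + 1 := le_antisymm (hD i) (by omega)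
        simp [this]
  | succ t ih =>
    rw [expectation_succ_eq_sum, div_le_iff₀ (by positivity)]
    set r : (jellyfish c k l f).edgeSet → Fin k → Prop := fun e i =>
      D i ≤ l ∧ Crosses (e : Sym2 _) (pathTail c i l (D i)) with hr
    calc _ ≤ ∑ e : (jellyfish c k l f).edgeSet,
          ∏ i, ((1 - ((1 / 2) ^ D i * q ^ t - (1 / 2) ^ (l + 1))) +
            if r e i then (1 / 2) ^ (D i + 1) * q ^ t else 0) := by
          refine Finset.sum_le_sum fun e _ => ?_
          -- Lengthening tail `i` by one raises its factor by `(1 / 2) ^ (D i + 1) * q ^ t`, half of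
          -- the subtracted main term.
          refine (expectation_mono t fun x => tailsHit_update_le f e.2 D x).trans ?_
          refine (ih _ fun i => ?_).trans_eq (Finset.prod_congr rfl fun i _ => ?_)
          · have := hD i
            split_ifs <;> omega
          · by_cases h : r e i
            · rw [if_pos h, if_pos h]
              ring
            · rw [if_neg h, if_neg h]
              ring
      _ ≤ Fintype.card (jellyfish c k l f).edgeSet *
          ∏ i, ((1 - ((1 / 2) ^ D i * q ^ t - (1 / 2) ^ (l + 1))) +
            (1 / 2) ^ (D i + 1) * q ^ t / Fintype.card (jellyfish c k l f).edgeSet) := by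
          -- Tails of different paths have different boundary edges, and each tail has at most one.
          refine sum_prod_add_ite_le r ?_ ?_ ?_ ?_
          · rintro e i j ⟨hi, hi'⟩ ⟨hj, hj'⟩
            obtain ⟨p, rfl, -, hp⟩ := hi'.exists_eq f e.2 hi
            obtain ⟨p', rfl, -, hp'⟩ := hj'.exists_eq f e.2 hj
            have hmem : Sum.inr p ∈ s(parent f p', Sum.inr p') := by rw [← hp', hp]; simp
            rcases Sym2.mem_iff.1 hmem with h | h
            · exact fst_eq_of_parent_eq_inr f h.symm
            · rw [Sum.inr.inj h]
          · rintro i e e' ⟨hi, hi'⟩ ⟨hj, hj'⟩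
            obtain ⟨p, hp1, hp2, hp⟩ := hi'.exists_eq f e.2 hi
            obtain ⟨p', hp1', hp2', hp'⟩ := hj'.exists_eq f e'.2 hj
            have : p = p' := Prod.ext (hp1.trans hp1'.symm) (Fin.ext (by omega))
            exact Subtype.ext (by rw [hp, hp', this])
          · intro i
            have h1 : (1 / 2 : ℝ) ^ D i * q ^ t ≤ 1 :=
              mul_le_one₀ (pow_le_one₀ (by norm_num) (by norm_num)) (by positivity)
                (pow_le_one₀ hq hq1)
            have h2 : (0 : ℝ) < (1 / 2) ^ (l + 1) := by positivity
            linarith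
          · intro i
            positivity
      _ = _ := by
          rw [mul_comm]
          congr 1
          refine Finset.prod_congr rfl fun i _ => ?_
          have : q ^ (t + 1) = q ^ t * (1 - 1 / (2 * Fintype.card (jellyfish c k l f).edgeSet)) := by
            rw [pow_succ, ← decayRate]
          rw [this]
          field_simp
          ring

/-- In a consensus state either all vertices are high, with probability `2 ^ (-n)` at all times, or
the last vertex of each path is low, which is `tailsHit` with all `D i = 1`. -/
lemma measureReal_isConsensus_le (hl : 1 ≤ l) (t : ℕ) :
    (sampleMeasure (jellyfish c k l f) 2 0).real {ω | IsConsensus (state ω t)} ≤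
      (1 - (1 / 2 * decayRate (jellyfish c k l f) ^ t - (1 / 2) ^ (l + 1))) ^ k +
        (1 / 2) ^ (c + k * l) := by
  classical
  rw [measureReal_state]
  have h := expectation_tailsHit_le (f := f) t (fun _ => 1) (fun _ => Nat.le_add_left 1 l)
  simp only [pow_one, Finset.prod_const, Finset.card_univ, Fintype.card_fin] at h
  have h2 := expectation_allHigh_univ (G := jellyfish c k l f) t
  simp only [Fintype.card_sum, Fintype.card_prod, Fintype.card_fin] at h2
  rw [← h2]
  refine le_trans ?_ (add_le_add_left h _)
  rw [← expectation_add]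
  refine expectation_mono t fun x => ?_
  have hnn : 0 ≤ tailsHit c l (fun _ => 1) x := by
    refine Finset.prod_nonneg fun i _ => ?_
    rw [if_pos hl]
    exact sub_nonneg.2 (allHigh_le_one _ _)
  have hnn' := allHigh_nonneg Finset.univ x
  simp only
  split_ifs with hx
  · by_cases h1 : ∀ v, x v = 1
    · have : allHigh Finset.univ x = 1 := by simp [allHigh, h1]
      linarith
    · have : tailsHit c l (fun _ => 1) x = 1 := by
        refine Finset.prod_eq_one fun i _ => ?_
        have : allHigh (pathTail c i l 1) x = 0 := by
          refine if_neg fun h => h1 fun v => ?_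
          rw [hx v]
          exact h (.inr (i, ⟨l - 1, by omega⟩)) (inr_mem_pathTail.2 ⟨rfl, by simp; omega⟩)
        rw [if_pos hl, this, sub_zero]
      linarith
  · linarith

end Jellyfish

/-- A walk from inside `B` to outside has an edge leaving `B`. -/
lemma exists_card_lt_card_absorb {V : Type*} [DecidableEq V] [Fintype V] {G : SimpleGraph V}
    (hG : G.Preconnected) {B : Finset V} (hB : B.Nonempty) (hB' : B ≠ Finset.univ) :
    ∃ e : G.edgeSet, B.card < (absorb (e : Sym2 V) B).card := by
  obtain ⟨u, hu⟩ := hB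
  obtain ⟨v, hv⟩ : ∃ v, v ∉ B := by
    by_contra! h
    exact hB' (Finset.eq_univ_iff_forall.2 h)
  obtain ⟨p⟩ := hG u v
  obtain ⟨d, -, hd1, hd2⟩ := p.exists_boundary_dart (B : Set V) hu hv
  refine ⟨⟨s(d.fst, d.snd), d.adj⟩, Finset.card_lt_card ⟨subset_absorb _ _, fun h => hd2 (h ?_)⟩⟩
  unfold absorb
  rw [if_pos ⟨d.fst, by simp, hd1⟩]
  simp

/-! ### Connectedness and number of edges of the jellyfish. -/

section Jellyfish

variable {c k l : ℕ} (f : Fin k → Fin c)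

lemma preconnected_jellyfish [NeZero c] : (jellyfish c k l f).Preconnected := by
  have h1 : ∀ a b : Fin c, (jellyfish c k l f).Reachable (.inl a) (.inl b) := by
    intro a b
    rcases eq_or_ne a b with rfl | h
    · rfl
    · exact (adj_inl f h).reachable
  have h2 : ∀ (i : Fin k) (s : ℕ) (hs : s < l),
      (jellyfish c k l f).Reachable (.inl 0) (.inr (i, ⟨s, hs⟩)) := by
    intro i s hs
    have hadj := (adj_parent f (i, (⟨s, hs⟩ : Fin l))).reachable
    induction s with
    | zero => exact (h1 0 (f i)).trans hadj
    | succ s ih =>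
      have hs' : s < l := by omega
      exact (ih hs' (adj_parent f (i, (⟨s, hs'⟩ : Fin l))).reachable).trans hadj
  have h3 : ∀ v, (jellyfish c k l f).Reachable (.inl 0) v := by
    rintro (a | ⟨i, s, hs⟩)
    exacts [h1 0 a, h2 i s hs]
  exact fun u v => (h3 u).symm.trans (h3 v)

variable {f} [Fintype (jellyfish c k l f).edgeSet]

lemma card_image_top_edgeFinset :
    ((⊤ : SimpleGraph (Fin c)).edgeFinset.image
      (Sym2.map (Sum.inl : Fin c → Fin c ⊕ Fin k × Fin l))).card = c.choose 2 := by
  rw [Finset.card_image_of_injective _ (Sym2.map.injective Sum.inl_injective),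
    SimpleGraph.card_edgeFinset_top_eq_card_choose_two, Fintype.card_fin]

lemma choose_two_le_card_edgeSet : c.choose 2 ≤ Fintype.card (jellyfish c k l f).edgeSet := by
  rw [← card_image_top_edgeFinset (k := k) (l := l), ← SimpleGraph.edgeFinset_card]
  refine Finset.card_le_card fun e he => ?_
  obtain ⟨e', he', rfl⟩ := Finset.mem_image.1 he
  clear he
  induction e' with | _ a b
  rw [SimpleGraph.mem_edgeFinset] at he' ⊢
  exact adj_inl f he'

lemma card_edgeSet_le : Fintype.card (jellyfish c k l f).edgeSet ≤ c.choose 2 + k * l := by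
  rw [← card_image_top_edgeFinset (k := k) (l := l), ← SimpleGraph.edgeFinset_card]
  have hkl : k * l = (Finset.univ : Finset (Fin k × Fin l)).card := by simp
  calc _ ≤ (_ ∪ (Finset.univ : Finset (Fin k × Fin l)).image fun p =>
        s(parent f p, .inr p)).card := Finset.card_le_card fun e he => ?_
    _ ≤ _ := by
      rw [hkl]
      exact (Finset.card_union_le _ _).trans (add_le_add le_rfl Finset.card_image_le)
  rw [SimpleGraph.mem_edgeFinset] at he
  rcases mem_edgeSet_cases f he with ⟨a, b, hab, rfl⟩ | ⟨p, rfl⟩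
  · exact Finset.mem_union_left _ (Finset.mem_image.2 ⟨s(a, b), by simpa using hab, rfl⟩)
  · exact Finset.mem_union_right _ (Finset.mem_image_of_mem _ (Finset.mem_univ p))

end Jellyfish

/-! ### Real estimates for the parameters and for both bounds. -/

section Asymptotics

open Real

/-- Rounding changes `n / L ^ 2 ≥ 4` by at most a quarter of it and `2 * L ≥ 4` by at most a quarter
of it. -/
lemma path_bounds {n k l L δ : ℝ} (hL : 2 ≤ L) (hδ : 4 ≤ δ * L)
    (hnL : 4 ≤ n / L ^ 2) (hk : |k - n / L ^ 2| < 1) (hl : |l - 2 * L| < 1) :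
    n / L ≤ k * l ∧ k * l ≤ δ * n ∧ 3 / 4 * (n / L ^ 2) ≤ k := by
  rw [abs_lt] at hk hl
  have hL0 : 0 < L := by linarith
  set a := n / L ^ 2 with ha
  have hna : n = a * L ^ 2 := by rw [ha]; field_simp
  have hnL' : n / L = a * L := by rw [hna]; field_simp
  refine ⟨?_, ?_, by linarith⟩
  · rw [hnL']
    calc a * L ≤ (3 / 4 * a) * (3 / 2 * L) := by nlinarith
      _ ≤ k * l := mul_le_mul (by linarith) (by linarith) (by positivity) (by linarith)
  · calc k * l ≤ (5 / 4 * a) * (5 / 2 * L) :=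
          mul_le_mul (by linarith) (by linarith) (by linarith) (by linarith)
      _ ≤ 4 * (a * L) := by nlinarith
      _ ≤ δ * L * (a * L) := by gcongr
      _ = δ * n := by rw [hna]; ring

lemma eventually_logb_sq_le {s : ℝ} (hs : 0 < s) :
    ∀ᶠ n : ℕ in atTop, logb 2 n ^ 2 ≤ (n : ℝ) ^ s := by
  have h := ((isLittleO_log_rpow_atTop (half_pos hs)).bound (log_pos one_lt_two)).natCast_atTop
  filter_upwards [h, eventually_ge_atTop 1] with n hn hn1
  have hn1' : (1 : ℝ) ≤ n := by exact_mod_cast hn1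
  have hn0 : (0 : ℝ) ≤ (n : ℝ) ^ (s / 2) := by positivity
  rw [norm_of_nonneg (log_nonneg hn1'), norm_of_nonneg hn0] at hn
  have h1 : logb 2 n ≤ (n : ℝ) ^ (s / 2) := by
    rw [logb, div_le_iff₀ (log_pos one_lt_two)]
    linarith
  calc logb 2 n ^ 2 ≤ ((n : ℝ) ^ (s / 2)) ^ 2 :=
        pow_le_pow_left₀ (logb_nonneg one_lt_two hn1') h1 2
    _ = (n : ℝ) ^ s := by
        rw [← rpow_natCast, ← rpow_mul (by positivity)]
        norm_num

lemma eventually_le_logb (C : ℝ) : ∀ᶠ n : ℕ in atTop, C ≤ logb 2 n :=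
  ((tendsto_logb_atTop one_lt_two).comp tendsto_natCast_atTop_atTop).eventually_ge_atTop C

lemma eventually_le_rpow {s : ℝ} (hs : 0 < s) (C : ℝ) : ∀ᶠ n : ℕ in atTop, C ≤ (n : ℝ) ^ s :=
  ((tendsto_rpow_atTop hs).comp tendsto_natCast_atTop_atTop).eventually_ge_atTop C

lemma eventually_le_div_logb_sq (C : ℝ) : ∀ᶠ n : ℕ in atTop, C ≤ n / logb 2 n ^ 2 := by
  filter_upwards [eventually_logb_sq_le one_half_pos, eventually_le_rpow one_half_pos C,
    eventually_le_logb 1] with n h1 h2 h3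
  refine h2.trans ?_
  rw [le_div_iff₀ (by positivity)]
  calc (n : ℝ) ^ (1 / 2 : ℝ) * logb 2 n ^ 2 ≤ (n : ℝ) ^ (1 / 2 : ℝ) * (n : ℝ) ^ (1 / 2 : ℝ) := by
        gcongr
    _ = n := by
        rw [← rpow_add_of_nonneg (by positivity) (by norm_num) (by norm_num)]
        norm_num

lemma log_eq_logb_mul_log_two (n : ℝ) : log n = logb 2 n * log 2 := by
  rw [logb, div_mul_cancel₀ _ (log_pos one_lt_two).ne']

/-- Here `y` is the number of path vertices. The saving `19 / 10 * n * y * log n` is at least `19 /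
10 * log 2 * n ^ 2`, which exceeds `M + 1`, roughly `n ^ 2 / 2`. -/
lemma edge_bound_upper {n y c M L : ℝ} (hn : 2 ≤ n) (hL : 0 < L) (hlog : log n = L * log 2)
    (hc : c = n - y) (hM : M ≤ c * (c - 1) / 2 + y) (hy : n / L ≤ y) (hy' : y ≤ 1 / 20 * n) :
    2 * M * log n + M + 1 ≤ n ^ 2 * log n := by
  have hy0 : 0 ≤ y := le_trans (by positivity) hy
  have h1 : 2 * M ≤ n ^ 2 - 19 / 10 * (n * y) := by
    subst hc
    nlinarith
  have hlog2 := log_two_gt_d9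
  have hlog0 : 0 ≤ log n := log_nonneg (by linarith)
  have h2 : n ≤ y * L := (div_le_iff₀ hL).1 hy
  have h3 : n * log 2 ≤ y * log n := by
    rw [hlog]; nlinarith
  have h4 : 2 * M * log n ≤ (n ^ 2 - 19 / 10 * (n * y)) * log n :=
    mul_le_mul_of_nonneg_right h1 hlog0
  have h5 : n * (n * log 2) ≤ n * (y * log n) := by gcongr
  nlinarith [mul_nonneg (by linarith : (0 : ℝ) ≤ n) hy0]

/-- The reciprocal of `1 - 1 / (2 * M)` is `1 + 1 / (2 * M - 1)`, at most `exp (1 / (2 * M - 1))`.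
-/
lemma exp_neg_le_one_sub_pow {M : ℝ} (hM : 1 ≤ M) (t : ℕ) :
    exp (-(t / (2 * M - 1))) ≤ (1 - 1 / (2 * M)) ^ t := by
  have h0 : 0 < 2 * M - 1 := by linarith
  have h1 : exp (-(1 / (2 * M - 1))) ≤ 1 - 1 / (2 * M) := by
    have h2 := add_one_le_exp (1 / (2 * M - 1))
    rw [exp_neg, inv_le_comm₀ (exp_pos _) (by
      rw [sub_pos, div_lt_one (by linarith)]; linarith)]
    refine le_trans (le_of_eq ?_) h2
    have h3 : 2 * M ≠ 0 := by positivity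
    rw [one_sub_div h3, inv_div]
    field_simp
    ring
  calc exp (-(t / (2 * M - 1))) = exp (-(1 / (2 * M - 1))) ^ t := by
        rw [← exp_nat_mul]; ring_nf
    _ ≤ _ := by gcongr

lemma one_sub_pow_le_exp {h : ℝ} (hh : h ≤ 1) (k : ℕ) : (1 - h) ^ k ≤ exp (-(k * h)) := by
  calc (1 - h) ^ k ≤ exp (-h) ^ k := by
        refine pow_le_pow_left₀ (by linarith) ?_ k
        · have := add_one_le_exp (-h)
          linarith
    _ = _ := by rw [← exp_nat_mul]; ring_nf

/-- The expected number of high path ends tends to infinity: `n * n ^ (-(1 - ε / 2)) = n ^ (ε / 2)`,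
and the division by `L ^ 2` costs at most `n ^ (ε / 4)`. -/
lemma le_mul_sub {n k L q w ε : ℝ} (hn : 4 ≤ n) (hε : 0 < ε) (hL : 0 < L)
    (hLn : L ^ 2 ≤ n ^ (ε / 4)) (hk : 3 / 4 * (n / L ^ 2) ≤ k)
    (hq : n ^ (-(1 - ε / 2)) ≤ q) (hw : w ≤ n ^ (-2 : ℝ)) :
    3 / 16 * n ^ (ε / 4) ≤ k * (1 / 2 * q - w) := by
  have hn0 : 0 < n := by linarith
  set u := n ^ (-(1 - ε / 2)) with hu
  have hu0 : 0 < u := by positivity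
  have h1 : n ^ (-2 : ℝ) ≤ 1 / 4 * u := by
    calc n ^ (-2 : ℝ) = n ^ (-1 : ℝ) * n ^ (-1 : ℝ) := by rw [← rpow_add hn0]; norm_num
      _ ≤ 1 / 4 * u := by
          refine mul_le_mul ?_ ?_ (by positivity) (by norm_num)
          · rw [rpow_neg_one, one_div]
            gcongr
          · exact rpow_le_rpow_of_exponent_le (by linarith) (by linarith)
  have h2 : 1 / 4 * u ≤ 1 / 2 * q - w := by linarith
  have h3 : n * u = n ^ (ε / 4) * n ^ (ε / 4) := by
    rw [hu, ← rpow_one_add' hn0.le (by linarith), ← rpow_add hn0]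
    ring_nf
  calc 3 / 16 * n ^ (ε / 4) = 3 / 16 * (n ^ (ε / 4) * n ^ (ε / 4) / n ^ (ε / 4)) := by field_simp
    _ ≤ 3 / 16 * (n ^ (ε / 4) * n ^ (ε / 4) / L ^ 2) := by gcongr
    _ = 3 / 4 * (n / L ^ 2) * (1 / 4 * u) := by rw [← h3]; ring
    _ ≤ k * (1 / 2 * q - w) := by gcongr; exact le_trans (by positivity) hk

/-- The loss `ε = 12 * δ` splits into `6 * δ` from the choice of `t`, `3 * δ` from the size of the
clique, `δ` from rounding `t` down and `2 * δ` from the probability of consensus. -/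
lemma time_bound_lower {n c M t ε δ p : ℝ} (hδ : 0 < δ) (hεδ : ε = 12 * δ) (hε : ε ≤ 1)
    (hn : 3 ≤ n) (hnδ : 2 ≤ δ * n) (hc : (1 - δ) * n ≤ c) (hcn : c ≤ n)
    (hM : c * (c - 1) / 2 ≤ M)
    (ht : (1 - ε / 2) * (2 * M - 1) * log n - 1 ≤ t) (hp : 1 - 2 * δ ≤ p) (ht0 : 0 ≤ t) :
    (1 - ε) * (n ^ 2 * log n) ≤ t * p := by
  have hlog : 1 ≤ log n := by
    rw [le_log_iff_exp_le (by linarith)]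
    linarith [exp_one_lt_three]
  have hc2 : ((1 - δ) * n) ^ 2 ≤ c ^ 2 := pow_le_pow_left₀ (by nlinarith) hc 2
  have hδn : 2 * n ≤ δ * n ^ 2 := by nlinarith
  have h1 : (1 - 3 * δ) * n ^ 2 ≤ 2 * M - 1 := by nlinarith [mul_nonneg (sq_nonneg δ) (sq_nonneg n)]
  have hX : n ^ 2 ≤ n ^ 2 * log n := le_mul_of_one_le_right (by positivity) hlog
  set X := n ^ 2 * log n with hXdef
  have h2 : (1 - ε / 2) * ((1 - 3 * δ) * X) ≤ (1 - ε / 2) * (2 * M - 1) * log n := by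
    rw [hXdef, mul_assoc (1 - ε / 2), ← mul_assoc (1 - 3 * δ)]
    gcongr
    linarith
  have h3 : 1 ≤ δ * X := by nlinarith
  have hX0 : 0 ≤ X := by positivity
  have h4 : (1 - 10 * δ) * X ≤ t := by
    subst hεδ
    nlinarith [mul_nonneg (sq_nonneg δ) hX0]
  calc (1 - ε) * X ≤ (1 - 10 * δ) * X * (1 - 2 * δ) := by
        subst hεδ
        nlinarith [mul_nonneg (sq_nonneg δ) hX0]
    _ ≤ t * (1 - 2 * δ) := by gcongr; linarith
    _ ≤ t * p := by gcongr

end Asymptotics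

/-! ### The two bounds for the jellyfish. -/

section Main

open Real

lemma card_edgeSet_cast_le {c k l : ℕ} {f : Fin k → Fin c}
    [Fintype (jellyfish c k l f).edgeSet] :
    (Fintype.card (jellyfish c k l f).edgeSet : ℝ) ≤ (c : ℝ) * (c - 1) / 2 + k * l := by
  rw [← Nat.cast_choose_two]
  exact_mod_cast card_edgeSet_le (f := f)

lemma le_card_edgeSet_cast {c k l : ℕ} {f : Fin k → Fin c}
    [Fintype (jellyfish c k l f).edgeSet] :
    (c : ℝ) * (c - 1) / 2 ≤ Fintype.card (jellyfish c k l f).edgeSet := by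
  rw [← Nat.cast_choose_two]
  exact_mod_cast choose_two_le_card_edgeSet (f := f)

lemma nonempty_edgeSet_jellyfish {c k l : ℕ} (f : Fin k → Fin c) (hc : 2 ≤ c) :
    Nonempty (jellyfish c k l f).edgeSet :=
  ⟨⟨s(.inl ⟨0, by omega⟩, .inl ⟨1, by omega⟩), adj_inl f (by simp)⟩⟩

lemma eventually_expectedTime_le :
    ∀ᶠ n : ℕ in atTop, ∀ (c k l : ℕ) (f : Fin k → Fin c),
      |(k : ℝ) - n / (logb 2 n) ^ 2| < 1 → |(l : ℝ) - 2 * logb 2 n| < 1 → c + k * l = n →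
      expectedTime (jellyfish c k l f) 2 0 ≤ ENNReal.ofReal ((n : ℝ) ^ 2 * log n) := by
  classical
  -- The value `80` allows `δ = 1 / 20` in `path_bounds`, the fraction that `edge_bound_upper`
  -- requires.
  filter_upwards [eventually_le_logb 80, eventually_le_div_logb_sq 4, eventually_ge_atTop 4]
    with n hL hnL hn c k l f hk hl hcn
  obtain ⟨h1, h2, -⟩ := path_bounds (δ := 1 / 20) (by linarith) (by linarith) hnL hk hl
  have hn' : (4 : ℝ) ≤ n := by exact_mod_cast hn
  have hcn' : (c : ℝ) + k * l = n := by exact_mod_cast hcn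
  have hc2 : 2 ≤ c := by
    have : (2 : ℝ) ≤ c := by linarith
    exact_mod_cast this
  have : NeZero c := ⟨by omega⟩
  have := nonempty_edgeSet_jellyfish (l := l) f hc2
  have : Fintype (jellyfish c k l f).edgeSet := Fintype.ofFinite _
  refine (expectedTime_le fun B => exists_card_lt_card_absorb (preconnected_jellyfish f)).trans ?_
  refine ENNReal.ofReal_le_ofReal ?_
  have hcard : (Fintype.card (Fin c ⊕ Fin k × Fin l) : ℝ) = n := by
    simpa using hcn'
  rw [hcard]
  exact edge_bound_upper (by linarith) (by linarith) (log_eq_logb_mul_log_two _)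
    (eq_sub_of_add_eq hcn') card_edgeSet_cast_le h1 h2

lemma eventually_le_expectedTime {ε : ℝ} (hε : 0 < ε) (hε1 : ε ≤ 1) :
    ∀ᶠ n : ℕ in atTop, ∀ (c k l : ℕ) (f : Fin k → Fin c),
      |(k : ℝ) - n / (logb 2 n) ^ 2| < 1 → |(l : ℝ) - 2 * logb 2 n| < 1 → c + k * l = n →
      ENNReal.ofReal ((1 - ε) * ((n : ℝ) ^ 2 * log n)) ≤
        expectedTime (jellyfish c k l f) 2 0 := by
  classical
  obtain ⟨δ, hδ, hεδ⟩ : ∃ δ, 0 < δ ∧ ε = 12 * δ := ⟨ε / 12, by positivity, by ring⟩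
  have hpow : ∀ᶠ n : ℕ in atTop, (1 / 2 : ℝ) ^ n ≤ δ :=
    (tendsto_pow_atTop_nhds_zero_of_lt_one (by norm_num) (by norm_num)).eventually_le_const hδ
  filter_upwards [eventually_le_logb 2, eventually_le_logb (4 / δ), eventually_le_div_logb_sq 4,
    eventually_ge_atTop 4, hpow, eventually_ge_atTop ⌈2 / δ⌉₊,
    eventually_logb_sq_le (s := ε / 4) (by positivity),
    eventually_le_rpow (s := ε / 4) (by positivity) (16 / 3 * -log δ)]
    with n hL hLδ hnL hn hpow hnδ hLn hnC c k l f hk hl hcn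
  obtain ⟨h1, h2, h3⟩ := path_bounds (δ := δ) (by linarith)
    (by rwa [div_le_iff₀ hδ, mul_comm] at hLδ) hnL hk hl
  have hn' : (4 : ℝ) ≤ n := by exact_mod_cast hn
  have hn0 : (0 : ℝ) < n := by linarith
  have hnδ' : 2 ≤ δ * n := by
    have := Nat.ceil_le.1 hnδ
    rwa [div_le_iff₀ hδ, mul_comm] at this
  have hcn' : (c : ℝ) + k * l = n := by exact_mod_cast hcn
  have hc2 : 2 ≤ c := by
    have : (2 : ℝ) ≤ c := by nlinarith
    exact_mod_cast this
  have hl1 : 1 ≤ l := by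
    have : (1 : ℝ) < l := by linarith [(abs_lt.1 hl).1]
    exact_mod_cast this.le
  have := nonempty_edgeSet_jellyfish (l := l) f hc2
  have : Fintype (jellyfish c k l f).edgeSet := Fintype.ofFinite _
  set M := (Fintype.card (jellyfish c k l f).edgeSet : ℝ) with hMdef
  have hM : (1 : ℝ) ≤ M := Nat.one_le_cast.2 Fintype.card_pos
  have hlog : 0 ≤ log n := log_nonneg (by linarith)
  have hA : 0 ≤ (1 - ε / 2) * (2 * M - 1) * log n :=
    mul_nonneg (mul_nonneg (by linarith) (by linarith)) hlog
  set t := ⌊(1 - ε / 2) * (2 * M - 1) * log n⌋₊ with htdef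
  set q := decayRate (jellyfish c k l f) with hqdef
  have hq : (n : ℝ) ^ (-(1 - ε / 2)) ≤ q ^ t := by
    refine le_trans ?_ (exp_neg_le_one_sub_pow hM t)
    rw [rpow_def_of_pos hn0]
    refine exp_le_exp.2 ?_
    rw [mul_neg, neg_le_neg_iff, div_le_iff₀ (by linarith)]
    have := Nat.floor_le hA
    linarith
  -- This is where the length `2 * log₂ n` enters: `l + 1 > 2 * log₂ n` makes the correction
  -- negligible against `q ^ t`.
  have hw : (1 / 2 : ℝ) ^ (l + 1) ≤ (n : ℝ) ^ (-2 : ℝ) := by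
    rw [← Real.rpow_natCast, one_div, Real.inv_rpow (by norm_num), ← Real.rpow_neg (by norm_num)]
    conv_rhs => rw [← Real.rpow_logb two_pos (by norm_num) hn0, ← Real.rpow_mul two_pos.le]
    refine rpow_le_rpow_of_exponent_le one_le_two ?_
    push_cast
    linarith [(abs_lt.1 hl).1]
  have hX := le_mul_sub hn' hε (by linarith) hLn h3 hq hw
  have hh : 1 / 2 * q ^ t - (1 / 2) ^ (l + 1) ≤ 1 := by
    have hq1 : q ≤ 1 := by
      have : 0 ≤ 1 / (2 * M) := by positivity
      rw [hqdef, decayRate]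
      linarith
    have h4 : q ^ t ≤ 1 := pow_le_one₀ decayRate_nonneg hq1
    have h5 : (0 : ℝ) < (1 / 2) ^ (l + 1) := by positivity
    linarith
  have hcons : (sampleMeasure (jellyfish c k l f) 2 0).real {ω | IsConsensus (state ω t)} ≤
      2 * δ := by
    refine (measureReal_isConsensus_le hl1 t).trans ?_
    rw [hcn, two_mul]
    refine add_le_add ((one_sub_pow_le_exp hh k).trans ?_) hpow
    rw [← le_log_iff_exp_le hδ]
    linarith
  have hncons : 1 - 2 * δ ≤
      (sampleMeasure (jellyfish c k l f) 2 0).real {ω | ¬ IsConsensus (state ω t)} := by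
    have h4 := probReal_add_probReal_compl (μ := sampleMeasure (jellyfish c k l f) 2 0)
      (measurableSet_not_isConsensus (G := jellyfish c k l f) (m := 2) t)
    have h5 : {ω : Sample (jellyfish c k l f) 2 | ¬ IsConsensus (state ω t)}ᶜ =
        {ω | IsConsensus (state ω t)} := by
      ext ω
      simp
    rw [h5] at h4
    linarith
  refine le_trans ?_ (mul_measure_le_expectedTime 0 t)
  rw [← ofReal_measureReal, ← ENNReal.ofReal_natCast t,
    ← ENNReal.ofReal_mul (Nat.cast_nonneg t)]
  refine ENNReal.ofReal_le_ofReal (time_bound_lower hδ hεδ hε1 (by linarith) hnδ' ?_ ?_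
    le_card_edgeSet_cast (Nat.sub_one_lt_floor _).le hncons (Nat.cast_nonneg t))
  · linarith
  · have : (0 : ℝ) ≤ k * l := by positivity
    linarith

end Main

end EdgeConsensus

end

/-- The jellyfish on `n` vertices has `k` pendant paths of length `l` each, where `k` and `l` are
`n / (log₂ n)²` and `2 log₂ n`, rounded up or down, and the other `c` vertices form the clique. For
the process with two strategies and `p = 0`, the expected time is `(1 - δ) n² log n` with a
nonnegative `δ` that tends to `0` as `n` tends to infinity. -/
theorem mainTheorem4 :
    ∀ ε : ℝ, 0 < ε → ∀ᶠ n : ℕ in atTop,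
      ∀ (c k l : ℕ) (f : Fin k → Fin c),
        |(k : ℝ) - n / (Real.logb 2 n) ^ 2| < 1 →
        |(l : ℝ) - 2 * Real.logb 2 n| < 1 →
        c + k * l = n →
        EdgeConsensus.IsBalanced f →
        ENNReal.ofReal ((1 - ε) * ((n : ℝ) ^ 2 * Real.log n)) ≤
            EdgeConsensus.expectedTime (EdgeConsensus.jellyfish c k l f) 2 0 ∧
          EdgeConsensus.expectedTime (EdgeConsensus.jellyfish c k l f) 2 0 ≤
            ENNReal.ofReal ((n : ℝ) ^ 2 * Real.log n) := by
  intro ε hε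
  -- For `ε > 1` the lower bound follows from the case `ε = 1`.
  filter_upwards [EdgeConsensus.eventually_expectedTime_le,
    EdgeConsensus.eventually_le_expectedTime (lt_min hε one_pos) (min_le_right ε 1)]
    with n hu hl c k l f hk hl' hcn _
  refine ⟨le_trans (ENNReal.ofReal_le_ofReal ?_) (hl c k l f hk hl' hcn), hu c k l f hk hl' hcn⟩
  have : 0 ≤ (n : ℝ) ^ 2 * Real.log n := mul_nonneg (by positivity) (Real.log_natCast_nonneg n)
  exact mul_le_mul_of_nonneg_right (by linarith [min_le_left ε 1]) this
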